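/- \textbf{Fractional $q$-paging.} Let $P$ be a set of pages and $k\ge 1$ the cache size. For a finite request sequence $\sigma=(p_1,\dots,p_T)$ in $P$ let $r(p,t)$ be the number of requests to $p$ in rounds $1,\dots,t$, and let $B(t)=\{p : r(p,t)\ge 1\}$. A fractional solution for $\sigma$ consists of variables $x_{p,j}\in[0,1]$ ($p\in B(T)$, $1\le j\le r(p,T)$), where $x_{p,j}$ is the fraction of page $p$ evicted between its $j$-th and its $(j+1)$-st request (after its $j$-th request, if that is the last one). It is feasible if $$\sum_{p\in B(t)\setminus\{p_t\}} x_{p,r(p,t)}\ \ge\ |B(t)|-k\qquad\text{for all } t=1,\dots,T.$$ For real $q\ge 1$ its cost is the $\ell_q$-norm of the per-page eviction totals, $$\mathrm{cost}_q(\sigma,x)=\Bigl(\sum_{p\in B(T)}\Bigl(\sum_{j=1}^{r(p,T)}x_{p,j}\Bigr)^{q}\Bigr)^{1/q}.$$ A (deterministic) online algorithm maintains, after each round $t$, a feasible solution for $(p_1,\dots,p_t)$ that depends only on $p_1,\dots,p_t$. The variable $x_{p_t,r(p_t,t)}$ created in round $t$ has the value $0$ at the end of that round; variables are never decreased; and $x_{p,j}$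 is no longer changed once the $(j+1)$-st request to $p$ has arrived. The algorithm is $c$-competitive if, for every finite request sequence $\sigma$, its final solution $\bar x$ satisfies $\mathrm{cost}_q(\sigma,\bar x)\le c\cdot \mathrm{cost}_q(\sigma,x)$ for every feasible fractional solution $x$ for $\sigma$. \textbf{Theorem.} For every set $P$ of pages, every integer $k\ge 1$ and every $q\in[1,\infty)$ there is a $2q\ln(k+1)$-competitive online algorithm for fractional $q$-paging with a cache of size $k$. -/

import Mathlib

/-! Fractional paging. A request sequence is a finite list `σ` of pages. The variable `x p j`
(`1 ≤ j ≤` number of requests to `p`) is the fraction of page `p` that is evicted from the cache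
between the `j`-th and the `(j+1)`-st request to `p` (after the `j`-th one, if it is the last).
Values of `x` at other indices are never used. -/

namespace FractionalPaging

variable {P : Type*} [DecidableEq P]

/-- `x` is a feasible fractional solution for `σ` with a cache of size `k`: all variables lie in
`[0, 1]`, and in every round (the `t`-th request being `σ[t]`, counted from `0`), with `B` the set
of pages requested so far, the current variables of the pages in `B` other than the requested one
add up to at least `|B| - k`. -/
def Feasible (k : ℕ) (σ : List P) (x : P → ℕ → ℝ) : Prop :=
  (∀ p : P, ∀ j : ℕ, 1 ≤ j → j ≤ σ.count p → 0 ≤ x p j ∧ x p j ≤ 1) ∧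
  ∀ (t : ℕ) (ht : t < σ.length),
    (((σ.take (t + 1)).toFinset.card : ℕ) : ℝ) - (k : ℝ) ≤
      ∑ p ∈ (σ.take (t + 1)).toFinset.erase σ[t], x p ((σ.take (t + 1)).count p)

/-- The total amount of page `p` that is evicted while serving `σ`. -/
def evictions (σ : List P) (x : P → ℕ → ℝ) (p : P) : ℝ :=
  ∑ j ∈ Finset.Icc 1 (σ.count p), x p j

/-- The objective of `q`-paging: the `ℓ_q`-norm of the vector of per-page eviction totals
(a page that is never requested has eviction total `0`). -/
noncomputable def cost (q : ℝ) (σ : List P) (x : P → ℕ → ℝ) : ℝ :=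
  (∑ p ∈ σ.toFinset, (evictions σ x p) ^ q) ^ (1 / q)

/-- A (deterministic) online algorithm for fractional paging with a cache of size `k`.
`sol σ` is the solution held after the requests of `σ` have been served; so it
depends on the requests seen so far only. -/
structure OnlineAlgorithm (P : Type*) [DecidableEq P] (k : ℕ) where
  /-- the values of the variables after serving a request sequence -/
  sol : List P → P → ℕ → ℝ
  /-- every constraint revealed so far is satisfied -/
  feasible : ∀ σ : List P, Feasible k σ (sol σ)
  /-- the variable created by a request is `0` at the end of the round of that request: the
  requested page is fully in the cache -/
  fresh : ∀ (σ : List P) (a : P), sol (σ ++ [a]) a (σ.count a + 1) = 0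
  /-- variables are never decreased -/
  mono : ∀ (σ : List P) (a p : P) (j : ℕ), 1 ≤ j → j ≤ σ.count p →
    sol σ p j ≤ sol (σ ++ [a]) p j
  /-- a variable is not changed any more once the next request to its page has arrived -/
  frozen : ∀ (σ : List P) (a p : P) (j : ℕ), 1 ≤ j → j ≤ σ.count p →
    j < (σ ++ [a]).count p → sol (σ ++ [a]) p j = sol σ p j

/-- The algorithm is `c`-competitive for `q`-paging: on every request sequence its cost is at most
`c` times the cost of every (in particular, of an optimal) offline fractional solution. -/
def OnlineAlgorithm.IsCompetitive {k : ℕ} (A : OnlineAlgorithm P k) (q c : ℝ) : Prop :=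
  ∀ (σ : List P) (y : P → ℕ → ℝ), Feasible k σ y → cost q σ (A.sol σ) ≤ c * cost q σ y

end FractionalPaging

namespace FractionalPaging

open Set Filter

/-! The algorithm is a continuous primal-dual scheme. On a request to `a`, the current variables of
all other known pages grow simultaneously until the new constraint holds. A variable with value `s`,
whose page has `C` evicted earlier, grows at rate `(s + 1/k) / (C + s)^(q-1)` and stops at `1`. With
`E p` the evictions of the algorithm and `y` any feasible offline solution, the invariant is `∑ E p
^ q ≤ 2q ∑ y p j * d p j`, where `d p j` is the total time during which `x p j` has grown.

In one round of length `τ`, page `p` raises the left side by at most `q (v p + 1/k) d p`, with `v p`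
its final value and `d p ≤ τ` its growing time (`rpow_sub_rpow_le`). Feasibility of `y` and a count
of unsaturated pages bound the sum of these by the growth of the right side
(`sum_primal_le_sum_dual`).

Raising a variable up to at most `1` takes time at most `E p ^ (q-1) * log (k+1)` (`dualTerm_le`).
Hölder's inequality then gives `∑ E p ^ q ≤ 2q log (k+1) * (∑ E p ^ q)^(1-1/q) * cost y`, and
dividing by the power of `∑ E p ^ q` finishes. -/

/-- The integrand of `dualTime`. The absolute value makes it continuous on the whole real line. -/
noncomputable def dualRate (q c C s : ℝ) : ℝ := (C + s) ^ (q - 1) / (|s| + c)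

/-- The time needed to raise a variable from `0` to `x` if it grows at the rate
`(s + c) / (C + s) ^ (q - 1)` when it has the value `s`; here `C` is the amount of the page that
had been evicted before. -/
noncomputable def dualTime (q c C x : ℝ) : ℝ := ∫ s in (0 : ℝ)..x, dualRate q c C s

/-! ### Growth of a single variable -/

section DualTime

variable {q c C : ℝ}

lemma continuous_dualRate (hq : 1 ≤ q) (hc : 0 < c) : Continuous (dualRate q c C) := by
  unfold dualRate
  refine Continuous.div ?_ (by fun_prop) (fun s => by positivity)
  exact (continuous_const.add continuous_id).rpow_const (fun _ => Or.inr (by linarith))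

lemma intervalIntegrable_dualRate (hq : 1 ≤ q) (hc : 0 < c) (a b : ℝ) :
    IntervalIntegrable (dualRate q c C) MeasureTheory.volume a b :=
  (continuous_dualRate hq hc).intervalIntegrable a b

@[simp] lemma dualTime_zero : dualTime q c C 0 = 0 := by simp [dualTime]

lemma dualTime_sub (hq : 1 ≤ q) (hc : 0 < c) (x v : ℝ) :
    dualTime q c C v - dualTime q c C x = ∫ s in x..v, dualRate q c C s :=
  intervalIntegral.integral_interval_sub_left (intervalIntegrable_dualRate hq hc _ _)
    (intervalIntegrable_dualRate hq hc _ _)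

lemma continuous_dualTime (hq : 1 ≤ q) (hc : 0 < c) : Continuous (dualTime q c C) :=
  intervalIntegral.continuous_primitive (intervalIntegrable_dualRate hq hc) 0

lemma strictMonoOn_dualTime (hq : 1 ≤ q) (hc : 0 < c) (hC : 0 ≤ C) :
    StrictMonoOn (dualTime q c C) (Icc 0 1) := by
  intro x hx v hv hxv
  rw [← sub_pos, dualTime_sub hq hc]
  refine intervalIntegral.intervalIntegral_pos_of_pos_on (intervalIntegrable_dualRate hq hc _ _)
    (fun s hs => ?_) hxv
  have hs0 : 0 < s := hx.1.trans_lt hs.1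
  unfold dualRate
  positivity

/-- The left side is `q` times the integral of `(C + s)^(q-1) = (s + c) * dualRate q c C s`, and `s
+ c ≤ v + c` on the interval. -/
lemma rpow_sub_rpow_le (hq : 1 ≤ q) (hc : 0 < c) (hC : 0 ≤ C) {x v : ℝ} (hx : 0 ≤ x)
    (hxv : x ≤ v) :
    (C + v) ^ q - (C + x) ^ q ≤ q * ((v + c) * (dualTime q c C v - dualTime q c C x)) := by
  have key : ∫ s in x..v, (C + s) ^ (q - 1) ≤ ∫ s in x..v, (v + c) * dualRate q c C s := by
    refine intervalIntegral.integral_mono_on hxv ?_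
      ((intervalIntegrable_dualRate hq hc _ _).const_mul _) (fun s hs => ?_)
    · exact ((continuous_const.add continuous_id).rpow_const
        (fun _ => Or.inr (by linarith))).intervalIntegrable _ _
    · have hs0 : 0 ≤ s := hx.trans hs.1
      have hp : 0 ≤ (C + s) ^ (q - 1) := by positivity
      unfold dualRate
      rw [abs_of_nonneg hs0, ← mul_div_assoc, le_div_iff₀ (by positivity), mul_comm]
      gcongr
      exact hs.2
  rw [intervalIntegral.integral_const_mul, ← dualTime_sub hq hc,
    intervalIntegral.integral_comp_add_left (fun s => s ^ (q - 1)),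
    integral_rpow (Or.inl (by linarith)), sub_add_cancel, div_le_iff₀ (by linarith)] at key
  linarith

/-- Bound the power in the integrand by its value at the endpoint `x`; what remains integrates to
the logarithm. -/
lemma dualTime_le (hq : 1 ≤ q) (hc : 0 < c) (hC : 0 ≤ C) {x : ℝ} (hx : 0 ≤ x) :
    dualTime q c C x ≤ (C + x) ^ (q - 1) * Real.log ((x + c) / c) := by
  have hint : ∫ s in (0 : ℝ)..x, (s + c)⁻¹ = Real.log ((x + c) / c) := by
    rw [intervalIntegral.integral_comp_add_right (fun s => s⁻¹),
      integral_inv_of_pos (by linarith) (by linarith), zero_add]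
  rw [← hint, ← intervalIntegral.integral_const_mul]
  refine intervalIntegral.integral_mono_on hx (intervalIntegrable_dualRate hq hc _ _) ?_
    (fun s hs => ?_)
  · refine ContinuousOn.intervalIntegrable ?_
    refine continuousOn_const.mul (ContinuousOn.inv₀ (by fun_prop) (fun s hs => ?_))
    rw [uIcc_of_le hx] at hs
    linarith [hs.1]
  · have hs0 : 0 ≤ s := hs.1
    unfold dualRate
    rw [abs_of_nonneg hs0, div_eq_mul_inv]
    have : (C + s) ^ (q - 1) ≤ (C + x) ^ (q - 1) :=
      Real.rpow_le_rpow (by positivity) (by linarith [hs.2]) (by linarith)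
    gcongr

end DualTime

/-! ### Raising all variables simultaneously -/

/-- A strictly increasing continuous function on `[0, 1]` has a continuous inverse, extended by
`1` to the right. -/
lemma exists_continuous_inverse {f : ℝ → ℝ} (hf : Continuous f) (hm : StrictMonoOn f (Icc 0 1)) :
    ∃ g : ℝ → ℝ, Continuous g ∧ Monotone g ∧ (∀ y, 0 ≤ g y ∧ g y ≤ 1) ∧
      (∀ x ∈ Icc (0 : ℝ) 1, g (f x) = x) ∧ (∀ y, f 0 ≤ y → f (g y) ≤ y) ∧
      (∀ y, f 0 ≤ y → g y < 1 → f (g y) = y) ∧ ∀ y, f 1 ≤ y → g y = 1 := by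
  let pr : ℝ → ℝ := fun x => max 0 (min 1 x)
  have hpr : ∀ x, pr x ∈ Icc (0 : ℝ) 1 := fun x => ⟨le_max_left _ _, by simp [pr]⟩
  have hprm : Monotone pr := fun x y h => by simp only [pr]; gcongr
  have hprc : Continuous pr := by fun_prop
  have hprid : ∀ x ∈ Icc (0 : ℝ) 1, pr x = x := fun x hx => by simp [pr, hx.1, hx.2]
  have hprsub : Monotone fun x => x - pr x := by
    intro x y h
    simp only [pr]
    rcases max_cases 0 (min 1 x) with h1 | h1 <;> rcases max_cases 0 (min 1 y) with h2 | h2 <;>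
      rcases min_cases 1 x with h3 | h3 <;> rcases min_cases 1 y with h4 | h4 <;> linarith
  -- Extending `f` with slope `1` outside `[0, 1]` gives an increasing bijection of the line. Its
  -- inverse is continuous as an order isomorphism, and clamping it yields `g`.
  let F : ℝ → ℝ := fun x => f (pr x) + (x - pr x)
  have hFc : Continuous F := by fun_prop
  have hFm : StrictMono F := by
    intro x y h
    rcases (hprm h.le).eq_or_lt with he | hl
    · simp only [F, he]; linarith
    · exact add_lt_add_of_lt_of_le (hm (hpr x) (hpr y) hl) (hprsub h.le)
  have hm01 : ∀ x ∈ Icc (0 : ℝ) 1, f 0 ≤ f x ∧ f x ≤ f 1 := fun x hx =>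
    ⟨hm.monotoneOn (by simp) hx hx.1, hm.monotoneOn hx (by simp) hx.2⟩
  have hFs : Function.Surjective F := by
    refine hFc.surjective ?_ ?_
    · refine tendsto_atTop_mono (f := fun x => (f 0 - 1) + x) (fun x => ?_)
        (tendsto_atTop_add_const_left _ _ tendsto_id)
      have := (hm01 _ (hpr x)).1
      have := (hpr x).2
      simp only [F]; linarith
    · refine tendsto_atBot_mono (f := fun x => f 1 + x) (fun x => ?_)
        (tendsto_atBot_add_const_left _ _ tendsto_id)
      have := (hm01 _ (hpr x)).2
      have := (hpr x).1
      simp only [F]; linarith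
  let e := StrictMono.orderIsoOfSurjective F hFm hFs
  have hFe : ∀ y, F (e.symm y) = y := fun y => e.apply_symm_apply y
  have heF : ∀ x, e.symm (F x) = x := fun x => e.symm_apply_apply x
  have hFid : ∀ x ∈ Icc (0 : ℝ) 1, F x = f x := fun x hx => by simp [F, hprid x hx]
  have he0 : ∀ y, f 0 ≤ y → 0 ≤ e.symm y := fun y hy => by
    rw [← heF 0, hFid 0 (by simp)]; exact e.symm.monotone hy
  refine ⟨fun y => pr (e.symm y), hprc.comp e.symm.continuous, hprm.comp e.symm.monotone,
    fun y => hpr _, fun x hx => ?_, fun y hy => ?_, fun y hy h1 => ?_, fun y hy => ?_⟩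
  · rw [← hFid x hx]; simp only [heF, hprid x hx]
  · have h := hFe y
    have : pr (e.symm y) ≤ e.symm y := by simp [pr, he0 y hy]
    simp only [F] at h
    linarith
  · have h := hFe y
    have h2 : e.symm y < 1 := by
      by_contra! h3
      simp [pr, h3] at h1
    rwa [hFid _ ⟨he0 y hy, h2.le⟩, ← hprid _ ⟨he0 y hy, h2.le⟩] at h
  · have : 1 ≤ e.symm y := by
      rw [← heF 1, hFid 1 (by simp)]; exact e.symm.monotone hy
    simp [pr, this]

/-- The variables `x p` are raised until they add up to `m`, the time `f p (v p) - f p (x p)`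
being the same for all `p` for which `v p` stays below `1`. -/
lemma exists_raise {ι : Type*} (s : Finset ι) (f : ι → ℝ → ℝ) (x : ι → ℝ) (m : ℝ)
    (hf : ∀ p ∈ s, Continuous (f p)) (hm : ∀ p ∈ s, StrictMonoOn (f p) (Icc 0 1))
    (hx : ∀ p ∈ s, x p ∈ Icc (0 : ℝ) 1) (hle : m ≤ s.card) :
    ∃ (v : ι → ℝ) (τ : ℝ), 0 ≤ τ ∧ (∀ p ∈ s, x p ≤ v p ∧ v p ≤ 1) ∧ m ≤ ∑ p ∈ s, v p ∧
      (∀ p ∈ s, f p (v p) - f p (x p) ≤ τ) ∧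
      (∀ p ∈ s, v p < 1 → f p (v p) - f p (x p) = τ) ∧ (∑ p ∈ s, v p = m ∨ v = x ∧ τ = 0) := by
  by_cases hsum : m ≤ ∑ p ∈ s, x p
  · exact ⟨x, 0, le_rfl, fun p hp => ⟨le_rfl, (hx p hp).2⟩, hsum, by simp, by simp,
      Or.inr ⟨rfl, rfl⟩⟩
  push Not at hsum
  have hinv : ∀ p, ∃ g : ℝ → ℝ, p ∈ s → Continuous g ∧ Monotone g ∧ (∀ y, 0 ≤ g y ∧ g y ≤ 1) ∧
      (∀ x ∈ Icc (0 : ℝ) 1, g (f p x) = x) ∧ (∀ y, f p 0 ≤ y → f p (g y) ≤ y) ∧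
      (∀ y, f p 0 ≤ y → g y < 1 → f p (g y) = y) ∧ ∀ y, f p 1 ≤ y → g y = 1 := by
    intro p
    by_cases hp : p ∈ s
    · obtain ⟨g, hg⟩ := exists_continuous_inverse (hf p hp) (hm p hp)
      exact ⟨g, fun _ => hg⟩
    · exact ⟨id, fun h => absurd h hp⟩
  choose g hg using hinv
  have hf0 : ∀ p ∈ s, f p 0 ≤ f p (x p) := fun p hp =>
    (hm p hp).monotoneOn (by simp) (hx p hp) (hx p hp).1
  have hf1 : ∀ p ∈ s, f p (x p) ≤ f p 1 := fun p hp =>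
    (hm p hp).monotoneOn (hx p hp) (by simp) (hx p hp).2
  -- By time `T` every variable has reached `1`, so the intermediate value theorem on `[0, T]` finds
  -- the stopping time.
  let T : ℝ := ∑ p ∈ s, (f p 1 - f p (x p))
  have hT0 : 0 ≤ T := Finset.sum_nonneg fun p hp => sub_nonneg.2 (hf1 p hp)
  let G : ℝ → ℝ := fun τ => ∑ p ∈ s, g p (f p (x p) + τ)
  have hGc : Continuous G := continuous_finsetSum s fun p hp =>
    (hg p hp).1.comp (continuous_const.add continuous_id)
  have hG0 : G 0 = ∑ p ∈ s, x p := Finset.sum_congr rfl fun p hp => by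
    rw [add_zero, (hg p hp).2.2.2.1 _ (hx p hp)]
  have hGT : G T = s.card := by
    rw [Finset.card_eq_sum_ones, Nat.cast_sum, Nat.cast_one]
    refine Finset.sum_congr rfl fun p hp => (hg p hp).2.2.2.2.2.2 _ ?_
    have := Finset.single_le_sum (f := fun p => f p 1 - f p (x p))
      (fun p hp => sub_nonneg.2 (hf1 p hp)) hp
    simp only [T]
    linarith
  obtain ⟨τ, hτ, hGτ⟩ := intermediate_value_Icc hT0 hGc.continuousOn
    (show m ∈ Icc (G 0) (G T) by rw [hG0, hGT]; exact ⟨hsum.le, hle⟩)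
  refine ⟨fun p => g p (f p (x p) + τ), τ, hτ.1, fun p hp => ⟨?_, ((hg p hp).2.2.1 _).2⟩,
    hGτ.ge, fun p hp => ?_, fun p hp h1 => ?_, Or.inl hGτ⟩
  · conv_lhs => rw [← (hg p hp).2.2.2.1 _ (hx p hp)]
    exact (hg p hp).2.1 (by linarith [hτ.1])
  · have := (hg p hp).2.2.2.2.1 (f p (x p) + τ) (by linarith [hf0 p hp, hτ.1])
    linarith
  · have := (hg p hp).2.2.2.2.2.1 (f p (x p) + τ) (by linarith [hf0 p hp, hτ.1]) h1
    linarith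

/-! ### Primal against dual increase in one round -/

/-- The bound of the primal increase by the dual increase in one round. -/
lemma sum_primal_le_sum_dual {ι : Type*} (s : Finset ι) (k : ℕ) (hk : 1 ≤ k) (v d y : ι → ℝ)
    (τ : ℝ) (hτ : 0 ≤ τ) (hv : ∀ p ∈ s, 0 ≤ v p ∧ v p ≤ 1) (hd0 : ∀ p ∈ s, 0 ≤ d p)
    (hdτ : ∀ p ∈ s, d p ≤ τ) (hd : ∀ p ∈ s, v p < 1 → d p = τ) (hdv : ∀ p ∈ s, v p = 0 → d p = 0)
    (hsum : ∑ p ∈ s, v p = s.card + 1 - k) (hy1 : ∀ p ∈ s, y p ≤ 1)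
    (hy : (s.card : ℝ) + 1 - k ≤ ∑ p ∈ s, y p) :
    ∑ p ∈ s, (v p + 1 / k) * d p ≤ 2 * ∑ p ∈ s, y p * d p := by
  have hk0 : (0 : ℝ) < k := by exact_mod_cast hk
  have hk1 : (1 : ℝ) ≤ k := by exact_mod_cast hk
  -- Weak duality: `y p ≤ 1` and `d p ≤ τ` give `y p * d p ≥ τ * y p - (τ - d p)`.
  have hdual : τ * (s.card + 1 - k) - ∑ p ∈ s, (τ - d p) ≤ ∑ p ∈ s, y p * d p := by
    calc τ * (s.card + 1 - k) - ∑ p ∈ s, (τ - d p)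
        ≤ τ * ∑ p ∈ s, y p - ∑ p ∈ s, (τ - d p) := by gcongr
      _ = ∑ p ∈ s, (τ * y p - (τ - d p)) := by rw [Finset.mul_sum, ← Finset.sum_sub_distrib]
      _ ≤ ∑ p ∈ s, y p * d p := Finset.sum_le_sum fun p hp => by
          nlinarith [hy1 p hp, hdτ p hp]
  -- Complementary slackness: `v p = 1` or `d p = τ`, so `v` attains the dual bound exactly.
  have hprimal : ∑ p ∈ s, v p * d p = τ * (s.card + 1 - k) - ∑ p ∈ s, (τ - d p) := by
    rw [← hsum, Finset.mul_sum, ← Finset.sum_sub_distrib]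
    refine Finset.sum_congr rfl fun p hp => ?_
    rcases (hv p hp).2.lt_or_eq with h | h
    · rw [hd p hp h]; ring
    · rw [h]; ring
  have hzsum : ∑ p ∈ s, (τ - d p) = s.card * τ - ∑ p ∈ s, d p := by
    rw [Finset.sum_sub_distrib, Finset.sum_const, nsmul_eq_mul]
  -- The factor `k - 1` disposes of `k = 1`. Otherwise the deficits `1 - v p` sum to `k - 1` and, if
  -- `τ > 0`, each is below `1`; hence at least `k` pages are unsaturated and have `d p = τ`.
  have hcount : ((k : ℝ) - 1) * (k * τ) ≤ (k - 1) * ∑ p ∈ s, d p := by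
    rcases hk.eq_or_lt with rfl | hk2
    · simp
    refine mul_le_mul_of_nonneg_left ?_ (by linarith)
    rcases hτ.eq_or_lt with rfl | hτ0
    · rw [mul_zero]; exact Finset.sum_nonneg hd0
    have hvpos : ∀ p ∈ s, v p ≠ 0 := fun p hp h => by
      have h1 := hd p hp (by rw [h]; exact one_pos)
      rw [hdv p hp h] at h1
      exact hτ0.ne h1
    let U := s.filter fun p => v p < 1
    have hUs : U ⊆ s := Finset.filter_subset _ _
    have hU : ∑ p ∈ U, (1 - v p) = k - 1 := by
      rw [Finset.sum_filter_of_ne fun p hp h => lt_of_le_of_ne (hv p hp).2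
        fun h1 => h (by rw [h1, sub_self]), Finset.sum_sub_distrib, hsum,
        Finset.sum_const, nsmul_one]
      ring
    have hk2' : (1 : ℝ) < k := by exact_mod_cast hk2
    have hUne : U.Nonempty := by
      by_contra h
      rw [Finset.not_nonempty_iff_eq_empty] at h
      rw [h, Finset.sum_empty] at hU
      linarith
    have hlt : ∑ p ∈ U, (1 - v p) < ∑ p ∈ U, (1 : ℝ) :=
      Finset.sum_lt_sum_of_nonempty hUne fun p hp => by
        have := lt_of_le_of_ne (hv p (hUs hp)).1 (hvpos p (hUs hp)).symm
        linarith
    have hcard : k ≤ U.card := by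
      rw [hU, Finset.sum_const, nsmul_one] at hlt
      have : (k : ℝ) < (U.card + 1 : ℕ) := by push_cast; linarith
      exact Nat.lt_succ_iff.1 (by exact_mod_cast this)
    calc (k : ℝ) * τ ≤ U.card * τ := by gcongr
      _ = ∑ p ∈ U, d p := by
          rw [← nsmul_eq_mul, ← Finset.sum_const]
          exact Finset.sum_congr rfl fun p hp =>
            (hd p (hUs hp) (Finset.mem_filter.1 hp).2).symm
      _ ≤ ∑ p ∈ s, d p := Finset.sum_le_sum_of_subset_of_nonneg hUs fun p hp _ => hd0 p hp
  have hrest : 1 / (k : ℝ) * ∑ p ∈ s, d p ≤ τ * (s.card + 1 - k) - ∑ p ∈ s, (τ - d p) := by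
    rw [hzsum, one_div, inv_mul_le_iff₀ hk0]
    nlinarith
  simp only [add_mul, Finset.sum_add_distrib, ← Finset.mul_sum]
  linarith

/-! ### Appending a request -/

variable {P : Type*} [DecidableEq P]

lemma count_append_singleton_of_ne (σ : List P) {a p : P} (h : p ≠ a) :
    (σ ++ [a]).count p = σ.count p := by
  rw [List.count_append, List.count_singleton]
  simp [h.symm]

lemma count_append_singleton_self (σ : List P) (a : P) :
    (σ ++ [a]).count a = σ.count a + 1 := by simp

lemma mem_of_mem_toFinset_erase {σ : List P} {a p : P}
    (hp : p ∈ (σ ++ [a]).toFinset.erase a) : p ≠ a ∧ p ∈ σ := by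
  simp only [List.toFinset_append, Finset.mem_erase, Finset.mem_union, List.mem_toFinset,
    List.mem_singleton] at hp
  exact ⟨hp.1, hp.2.resolve_right hp.1⟩

lemma card_toFinset_append_singleton (σ : List P) (a : P) :
    (((σ ++ [a]).toFinset.card : ℕ) : ℝ) = ((σ ++ [a]).toFinset.erase a).card + 1 := by
  exact_mod_cast (Finset.card_erase_add_one (by simp)).symm

/-- Feasibility in the last round. -/
lemma Feasible.last {k : ℕ} {σ : List P} {a : P} {x : P → ℕ → ℝ} (h : Feasible k (σ ++ [a]) x) :
    (((σ ++ [a]).toFinset.card : ℕ) : ℝ) - k ≤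
      ∑ p ∈ (σ ++ [a]).toFinset.erase a, x p (σ.count p) := by
  have h2 := h.2 σ.length (by simp)
  have e : (σ ++ [a]).take (σ.length + 1) = σ ++ [a] := List.take_of_length_le (by simp)
  rw [e] at h2
  simp only [List.getElem_concat_length] at h2
  refine h2.trans_eq (Finset.sum_congr rfl fun p hp => ?_)
  rw [count_append_singleton_of_ne σ (mem_of_mem_toFinset_erase hp).1]

lemma Feasible.of_append {k : ℕ} {σ : List P} {a : P} {x : P → ℕ → ℝ}
    (h : Feasible k (σ ++ [a]) x) : Feasible k σ x := by
  refine ⟨fun p j h1 hj => h.1 p j h1 (hj.trans (by simp)), fun t ht => ?_⟩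
  have h2 := h.2 t (by simp; omega)
  rwa [List.take_append_of_le_length (by omega), List.getElem_append_left ht] at h2

lemma Feasible.append {k : ℕ} {σ : List P} {a : P} {x x' : P → ℕ → ℝ} (h : Feasible k σ x)
    (hmono : ∀ p j, 1 ≤ j → j ≤ σ.count p → x p j ≤ x' p j)
    (h01 : ∀ p j, 1 ≤ j → j ≤ (σ ++ [a]).count p → 0 ≤ x' p j ∧ x' p j ≤ 1)
    (hlast : (((σ ++ [a]).toFinset.card : ℕ) : ℝ) - k ≤
      ∑ p ∈ (σ ++ [a]).toFinset.erase a, x' p (σ.count p)) :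
    Feasible k (σ ++ [a]) x' := by
  refine ⟨h01, fun t ht => ?_⟩
  rcases lt_or_ge t σ.length with hlt | hge
  · rw [List.take_append_of_le_length (by omega), List.getElem_append_left hlt]
    refine (h.2 t hlt).trans (Finset.sum_le_sum fun p hp => hmono p _ ?_ ?_)
    · exact List.count_pos_iff.2 (List.mem_toFinset.1 (Finset.mem_of_mem_erase hp))
    · exact (List.take_sublist _ _).count_le p
  · obtain rfl : t = σ.length := by simp at ht; omega
    have e : (σ ++ [a]).take (σ.length + 1) = σ ++ [a] := List.take_of_length_le (by simp)
    rw [e]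
    simp only [List.getElem_concat_length]
    refine hlast.trans_eq (Finset.sum_congr rfl fun p hp => ?_)
    rw [count_append_singleton_of_ne σ (mem_of_mem_toFinset_erase hp).1]

lemma Feasible.evictions_nonneg {k : ℕ} {σ : List P} {x : P → ℕ → ℝ} (h : Feasible k σ x) (p : P) :
    0 ≤ evictions σ x p :=
  Finset.sum_nonneg fun j hj => (h.1 p j (Finset.mem_Icc.1 hj).1 (Finset.mem_Icc.1 hj).2).1

/-! ### The invariant and one step of the algorithm -/

/-- The contribution of page `p` to the dual value, if `y` is the offline solution. -/
noncomputable def dualTerm (q c : ℝ) (σ : List P) (x y : P → ℕ → ℝ) (p : P) : ℝ :=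
  ∑ j ∈ Finset.Icc 1 (σ.count p), y p j * dualTime q c (∑ i ∈ Finset.Ico 1 j, x p i) (x p j)

/-- A feasible solution whose cost is bounded by the dual value. -/
def Invariant (k : ℕ) (q : ℝ) (σ : List P) (x : P → ℕ → ℝ) : Prop :=
  Feasible k σ x ∧ ∀ y, Feasible k σ y →
    ∑ p ∈ σ.toFinset, evictions σ x p ^ q ≤ q * (2 * ∑ p ∈ σ.toFinset, dualTerm q (1 / k) σ x y p)

/-- A transition that an online algorithm may make when page `a` is requested. -/
def Transition (σ : List P) (a : P) (x x' : P → ℕ → ℝ) : Prop :=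
  x' a (σ.count a + 1) = 0 ∧ (∀ p j, 1 ≤ j → j ≤ σ.count p → x p j ≤ x' p j) ∧
    ∀ p j, 1 ≤ j → j ≤ σ.count p → j < (σ ++ [a]).count p → x' p j = x p j

lemma evictions_of_count_eq {σ τ : List P} {x x' : P → ℕ → ℝ} {p : P} (hc : τ.count p = σ.count p)
    (hpos : 1 ≤ σ.count p) (hx : ∀ j, j ≠ σ.count p → x' p j = x p j) :
    evictions τ x' p = ∑ i ∈ Finset.Ico 1 (σ.count p), x p i + x' p (σ.count p) := by
  rw [evictions, hc, ← Finset.sum_Ico_add_eq_sum_Icc hpos]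
  congr 1
  exact Finset.sum_congr rfl fun j hj => hx j (Finset.mem_Ico.1 hj).2.ne

lemma dualTerm_of_count_eq {q c : ℝ} {σ τ : List P} {x x' y : P → ℕ → ℝ} {p : P}
    (hc : τ.count p = σ.count p) (hpos : 1 ≤ σ.count p)
    (hx : ∀ j, j ≠ σ.count p → x' p j = x p j) :
    dualTerm q c τ x' y p =
      ∑ j ∈ Finset.Ico 1 (σ.count p), y p j * dualTime q c (∑ i ∈ Finset.Ico 1 j, x p i) (x p j) +
        y p (σ.count p) *
          dualTime q c (∑ i ∈ Finset.Ico 1 (σ.count p), x p i) (x' p (σ.count p)) := by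
  have hlow : ∀ j ≤ σ.count p, ∑ i ∈ Finset.Ico 1 j, x' p i = ∑ i ∈ Finset.Ico 1 j, x p i :=
    fun j hj => Finset.sum_congr rfl fun i hi =>
      hx i ((Finset.mem_Ico.1 hi).2.trans_le hj).ne
  rw [dualTerm, hc, ← Finset.sum_Ico_add_eq_sum_Icc hpos, hlow _ le_rfl]
  congr 1
  refine Finset.sum_congr rfl fun j hj => ?_
  have hj := (Finset.mem_Ico.1 hj).2
  rw [hx j hj.ne, hlow j hj.le]

/-- The fresh variable is `0`, so the requested page changes neither side of the invariant. -/
lemma evictions_requested {σ : List P} {a : P} {x x' : P → ℕ → ℝ}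
    (hx : ∀ j ≤ σ.count a, x' a j = x a j) (h0 : x' a (σ.count a + 1) = 0) :
    evictions (σ ++ [a]) x' a = evictions σ x a := by
  rw [evictions, count_append_singleton_self, Finset.sum_Icc_succ_top (by omega), h0, add_zero]
  exact Finset.sum_congr rfl fun j hj => hx j (Finset.mem_Icc.1 hj).2

lemma dualTerm_requested {q c : ℝ} {σ : List P} {a : P} {x x' y : P → ℕ → ℝ}
    (hx : ∀ j ≤ σ.count a, x' a j = x a j) (h0 : x' a (σ.count a + 1) = 0) :
    dualTerm q c (σ ++ [a]) x' y a = dualTerm q c σ x y a := by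
  rw [dualTerm, count_append_singleton_self, Finset.sum_Icc_succ_top (by omega), h0,
    dualTime_zero, mul_zero, add_zero]
  refine Finset.sum_congr rfl fun j hj => ?_
  have hj := (Finset.mem_Icc.1 hj).2
  rw [hx j hj, Finset.sum_congr rfl fun i hi => hx i ((Finset.mem_Ico.1 hi).2.le.trans hj)]

lemma sum_toFinset_append {σ : List P} {a : P} {F : P → ℝ} (hF : a ∉ σ → F a = 0) :
    ∑ p ∈ σ.toFinset, F p = F a + ∑ p ∈ (σ ++ [a]).toFinset.erase a, F p := by
  rw [Finset.add_sum_erase _ _ (by simp)]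
  refine Finset.sum_subset (fun p => by simp +contextual) fun p hp hp' => ?_
  simp only [List.toFinset_append, Finset.mem_union, List.mem_toFinset, List.mem_singleton]
    at hp hp'
  obtain rfl := hp.resolve_left hp'
  exact hF hp'

lemma Invariant.exists_step {k : ℕ} (hk : 1 ≤ k) {q : ℝ} (hq : 1 ≤ q) {σ : List P} (a : P)
    {x : P → ℕ → ℝ} (h : Invariant k q σ x) :
    ∃ x', Invariant k q (σ ++ [a]) x' ∧ Transition σ a x x' := by
  obtain ⟨hfeas, hpot⟩ := h
  have hc : (0 : ℝ) < 1 / k := by positivity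
  set s := (σ ++ [a]).toFinset.erase a with hs
  have hmem : ∀ p ∈ s, p ≠ a ∧ 1 ≤ σ.count p := fun p hp =>
    ⟨(mem_of_mem_toFinset_erase hp).1, List.count_pos_iff.2 (mem_of_mem_toFinset_erase hp).2⟩
  have hcard := card_toFinset_append_singleton σ a
  rw [← hs] at hcard
  let C : P → ℝ := fun p => ∑ i ∈ Finset.Ico 1 (σ.count p), x p i
  have hC : ∀ p, 0 ≤ C p := fun p => Finset.sum_nonneg fun i hi =>
    (hfeas.1 p i (Finset.mem_Ico.1 hi).1 (Finset.mem_Ico.1 hi).2.le).1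
  let f : P → ℝ → ℝ := fun p => dualTime q (1 / k) (C p)
  have hfm : ∀ p, StrictMonoOn (f p) (Icc 0 1) := fun p => strictMonoOn_dualTime hq hc (hC p)
  have hx01 : ∀ p ∈ s, x p (σ.count p) ∈ Icc (0 : ℝ) 1 := fun p hp =>
    hfeas.1 p _ (hmem p hp).2 le_rfl
  obtain ⟨v, τ, hτ, hxv, hmv, hdτ, hd, hor⟩ := exists_raise s f (fun p => x p (σ.count p))
    (s.card + 1 - k) (fun p _ => continuous_dualTime hq hc) (fun p _ => hfm p) hx01 (by
      have : (1 : ℝ) ≤ k := by exact_mod_cast hk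
      linarith)
  -- The value at index `σ.count a + 1` was irrelevant so far and may be nonzero, so it is reset
  -- explicitly.
  let x' : P → ℕ → ℝ := fun p j =>
    if p = a then if j = σ.count a + 1 then 0 else x a j
    else if p ∈ s ∧ j = σ.count p then v p else x p j
  have hx'a0 : x' a (σ.count a + 1) = 0 := by simp [x']
  have hx'a : ∀ j ≤ σ.count a, x' a j = x a j := fun j hj => by
    simp only [x', if_true]
    rw [if_neg (by omega)]
  have hx'v : ∀ p ∈ s, x' p (σ.count p) = v p := fun p hp => by
    simp [x', hp, (hmem p hp).1]
  have hx'x : ∀ p, p ≠ a → ∀ j, j ≠ σ.count p → x' p j = x p j := fun p hp j hj => by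
    simp [x', hp, hj]
  have hs_mem : ∀ p, p ≠ a → 1 ≤ σ.count p → p ∈ s := fun p hp h1 => by
    simp [hs, hp, List.count_pos_iff.1 h1]
  have hmono : ∀ p j, 1 ≤ j → j ≤ σ.count p → x p j ≤ x' p j := by
    intro p j h1 hj
    by_cases hpa : p = a
    · subst hpa; exact (hx'a j hj).ge
    by_cases hjc : j = σ.count p
    · subst hjc
      have hp := hs_mem p hpa h1
      rw [hx'v p hp]; exact (hxv p hp).1
    · exact (hx'x p hpa j hjc).ge
  have hfeas' : Feasible k (σ ++ [a]) x' := by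
    refine hfeas.append hmono ?_ ?_
    · intro p j h1 hj
      by_cases hpa : p = a
      · subst hpa
        rw [count_append_singleton_self] at hj
        rcases hj.lt_or_eq with hj | rfl
        · rw [hx'a j (by omega)]; exact hfeas.1 p j h1 (by omega)
        · rw [hx'a0]; simp
      rw [count_append_singleton_of_ne σ hpa] at hj
      refine ⟨(hfeas.1 p j h1 hj).1.trans (hmono p j h1 hj), ?_⟩
      by_cases hjc : j = σ.count p
      · subst hjc
        have hp := hs_mem p hpa h1
        rw [hx'v p hp]; exact (hxv p hp).2
      · rw [hx'x p hpa j hjc]; exact (hfeas.1 p j h1 hj).2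
    · rw [← hs, hcard, Finset.sum_congr rfl hx'v]
      exact hmv
  refine ⟨x', ⟨hfeas', fun y hy => ?_⟩, hx'a0, hmono, ?_⟩
  · have hold := hpot y hy.of_append
    -- Both old sums are rewritten over the new page set; if `a` is new, its term in each is `0`.
    rw [sum_toFinset_append (a := a), sum_toFinset_append (a := a)] at hold
    rotate_left
    · intro ha; simp [dualTerm, List.count_eq_zero_of_not_mem ha]
    · intro ha
      simp [evictions, List.count_eq_zero_of_not_mem ha, Real.zero_rpow (by linarith : q ≠ 0)]
    rw [← Finset.add_sum_erase _ _ (show a ∈ (σ ++ [a]).toFinset by simp),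
      ← Finset.add_sum_erase _ _ (show a ∈ (σ ++ [a]).toFinset by simp),
      evictions_requested hx'a hx'a0, dualTerm_requested hx'a hx'a0]
    rw [← hs] at hold ⊢
    have hprimal : ∀ p ∈ s, evictions (σ ++ [a]) x' p ^ q - evictions σ x p ^ q ≤
        q * ((v p + 1 / k) * (f p (v p) - f p (x p (σ.count p)))) := by
      intro p hp
      rw [evictions_of_count_eq (count_append_singleton_of_ne σ (hmem p hp).1) (hmem p hp).2
        (hx'x p (hmem p hp).1), evictions_of_count_eq rfl (hmem p hp).2 fun _ _ => rfl, hx'v p hp]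
      exact rpow_sub_rpow_le hq hc (hC p) (hx01 p hp).1 (hxv p hp).1
    have hdual : ∀ p ∈ s, y p (σ.count p) * (f p (v p) - f p (x p (σ.count p))) =
        dualTerm q (1 / k) (σ ++ [a]) x' y p - dualTerm q (1 / k) σ x y p := by
      intro p hp
      rw [dualTerm_of_count_eq (count_append_singleton_of_ne σ (hmem p hp).1) (hmem p hp).2
        (hx'x p (hmem p hp).1), dualTerm_of_count_eq rfl (hmem p hp).2 fun _ _ => rfl, hx'v p hp]
      simp only [f, C]
      ring
    have hmain : ∑ p ∈ s, (v p + 1 / k) * (f p (v p) - f p (x p (σ.count p))) ≤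
        2 * ∑ p ∈ s, y p (σ.count p) * (f p (v p) - f p (x p (σ.count p))) := by
      rcases hor with hsum | ⟨rfl, -⟩
      · have hv0 : ∀ p ∈ s, 0 ≤ v p := fun p hp => (hx01 p hp).1.trans (hxv p hp).1
        have hfv : ∀ p ∈ s, f p (x p (σ.count p)) ≤ f p (v p) := fun p hp =>
          (hfm p).monotoneOn (hx01 p hp) ⟨hv0 p hp, (hxv p hp).2⟩ (hxv p hp).1
        refine sum_primal_le_sum_dual s k hk v _ (fun p => y p (σ.count p)) τ hτ
          (fun p hp => ⟨hv0 p hp, (hxv p hp).2⟩) (fun p hp => sub_nonneg.2 (hfv p hp)) hdτ hd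
          (fun p hp h0 => ?_) hsum (fun p hp => ?_) ?_
        · have : x p (σ.count p) = v p := by linarith [(hx01 p hp).1, (hxv p hp).1]
          rw [this, sub_self]
        · exact (hy.of_append.1 p _ (hmem p hp).2 le_rfl).2
        · rw [← hcard]; exact hy.last
      · simp
    have h1 := Finset.sum_le_sum hprimal
    rw [Finset.sum_sub_distrib, ← Finset.mul_sum] at h1
    rw [Finset.sum_congr rfl hdual, Finset.sum_sub_distrib] at hmain
    have h2 := mul_le_mul_of_nonneg_left hmain (show (0 : ℝ) ≤ q by linarith)
    linarith
  · intro p j h1 hj hj'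
    by_cases hpa : p = a
    · subst hpa; exact hx'a j hj
    · rw [count_append_singleton_of_ne σ hpa] at hj'
      exact hx'x p hpa j hj'.ne

/-! ### Assembling the online algorithm -/

lemma invariant_nil {k : ℕ} {q : ℝ} (x : P → ℕ → ℝ) : Invariant k q [] x := by
  refine ⟨⟨fun p j h1 hj => ?_, fun t ht => ?_⟩, fun y _ => ?_⟩
  · simp at hj; omega
  · simp at ht
  · simp

/-- Construction of an online algorithm by its transitions. -/
lemma exists_online {α X : Type*} (Inv : List α → X → Prop) (R : List α → α → X → X → Prop)
    (x₀ : X) (h₀ : Inv [] x₀)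
    (hstep : ∀ σ a x, Inv σ x → ∃ x', Inv (σ ++ [a]) x' ∧ R σ a x x') :
    ∃ f : List α → X, (∀ σ, Inv σ (f σ)) ∧ ∀ σ a, R σ a (f σ) (f (σ ++ [a])) := by
  have hstep' : ∀ σ a x, ∃ x', Inv σ x → Inv (σ ++ [a]) x' ∧ R σ a x x' := fun σ a x => by
    by_cases h : Inv σ x
    · obtain ⟨x', hx'⟩ := hstep σ a x h
      exact ⟨x', fun _ => hx'⟩
    · exact ⟨x, fun h' => absurd h' h⟩
  choose F hF using hstep'
  -- The recursion runs on the reversed list because requests arrive at the end.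
  let f : List α → X := fun σ =>
    List.rec (motive := fun _ => X) x₀ (fun a l x => F l.reverse a x) σ.reverse
  have hf : ∀ σ a, f (σ ++ [a]) = F σ a (f σ) := fun σ a => by
    simp [f]
  have hInv : ∀ σ, Inv σ (f σ) := fun σ => by
    induction σ using List.reverseRecOn with
    | nil => exact h₀
    | append_singleton σ a ih => rw [hf]; exact (hF σ a _ ih).1
  exact ⟨f, hInv, fun σ a => by rw [hf]; exact (hF σ a _ (hInv σ)).2⟩

/-! ### From the invariant to the competitive ratio -/

lemma dualTerm_le {k : ℕ} (hk : 1 ≤ k) {q : ℝ} (hq : 1 ≤ q) {σ : List P} {x y : P → ℕ → ℝ}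
    (hx : Feasible k σ x) (hy : Feasible k σ y) (p : P) :
    dualTerm q (1 / k) σ x y p ≤
      Real.log (k + 1) * (evictions σ x p ^ (q - 1) * evictions σ y p) := by
  have hk0 : (0 : ℝ) < k := by exact_mod_cast hk
  rw [evictions.eq_1 σ y, Finset.mul_sum, Finset.mul_sum]
  refine Finset.sum_le_sum fun j hj => ?_
  obtain ⟨h1, hj⟩ := Finset.mem_Icc.1 hj
  have hx0 : ∀ i, 1 ≤ i → i ≤ σ.count p → 0 ≤ x p i := fun i hi hi' => (hx.1 p i hi hi').1
  have hC : 0 ≤ ∑ i ∈ Finset.Ico 1 j, x p i := Finset.sum_nonneg fun i hi =>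
    hx0 i (Finset.mem_Ico.1 hi).1 ((Finset.mem_Ico.1 hi).2.le.trans hj)
  have hxj := hx.1 p j h1 hj
  have hle : ∑ i ∈ Finset.Ico 1 j, x p i + x p j ≤ evictions σ x p := by
    rw [Finset.sum_Ico_add_eq_sum_Icc h1]
    exact Finset.sum_le_sum_of_subset_of_nonneg (Finset.Icc_subset_Icc_right hj) fun i hi _ =>
      hx0 i (Finset.mem_Icc.1 hi).1 (Finset.mem_Icc.1 hi).2
  -- With `c = 1/k` and `x p j ≤ 1` the ratio is `k * x p j + 1 ≤ k + 1`.
  have hlog : Real.log ((x p j + 1 / k) / (1 / k)) ≤ Real.log (k + 1) := by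
    refine Real.log_le_log (by have := hxj.1; positivity) ?_
    rw [div_le_iff₀ (by positivity), add_mul, mul_one_div_cancel hk0.ne']
    linarith [hxj.2]
  have hlog0 : 0 ≤ Real.log ((k : ℝ) + 1) := Real.log_nonneg (by linarith)
  have hpow : (∑ i ∈ Finset.Ico 1 j, x p i + x p j) ^ (q - 1) ≤ evictions σ x p ^ (q - 1) :=
    Real.rpow_le_rpow (by linarith [hxj.1]) hle (by linarith)
  have hpow0 : 0 ≤ evictions σ x p ^ (q - 1) :=
    Real.rpow_nonneg (hx.evictions_nonneg p) _
  have h := (dualTime_le hq (c := 1 / (k : ℝ)) (by positivity) hC hxj.1).trans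
    ((mul_le_mul_of_nonneg_left hlog (Real.rpow_nonneg (by linarith [hxj.1]) _)).trans
      (mul_le_mul_of_nonneg_right hpow hlog0))
  calc _ ≤ y p j * (evictions σ x p ^ (q - 1) * Real.log (k + 1)) :=
        mul_le_mul_of_nonneg_left h (hy.1 p j h1 hj).1
    _ = _ := by ring

/-- Hölder's inequality against the gradient of the `q`-th power of the `ℓ_q`-norm. -/
lemma sum_rpow_sub_one_mul_le {ι : Type*} (s : Finset ι) {q : ℝ} (hq : 1 ≤ q) {C D : ι → ℝ}
    (hC : ∀ p ∈ s, 0 ≤ C p) (hD : ∀ p ∈ s, 0 ≤ D p) :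
    ∑ p ∈ s, C p ^ (q - 1) * D p ≤
      (∑ p ∈ s, C p ^ q) ^ (1 - 1 / q) * (∑ p ∈ s, D p ^ q) ^ (1 / q) := by
  rcases hq.eq_or_lt with rfl | hq1
  -- For `q = 1` there is no finite conjugate exponent, but both exponents on `C` vanish and
  -- equality holds.
  · simp
  have hpq : (q / (q - 1)).HolderConjugate q := (Real.HolderConjugate.conjExponent hq1).symm
  have h := Real.inner_le_Lp_mul_Lq_of_nonneg s hpq
    (fun p hp => Real.rpow_nonneg (hC p hp) (q - 1)) hD
  have hq0 : q - 1 ≠ 0 := by linarith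
  have hq0' : q ≠ 0 := by linarith
  have hpow : ∑ p ∈ s, (C p ^ (q - 1)) ^ (q / (q - 1)) = ∑ p ∈ s, C p ^ q :=
    Finset.sum_congr rfl fun p hp => by rw [← Real.rpow_mul (hC p hp), mul_div_cancel₀ _ hq0]
  rwa [hpow, show 1 / (q / (q - 1)) = 1 - 1 / q by field_simp] at h

lemma rpow_le_of_le_mul_rpow {A c D q : ℝ} (hq : 1 ≤ q) (hA : 0 ≤ A) (hcD : 0 ≤ c * D)
    (h : A ≤ c * (A ^ (1 - 1 / q) * D)) : A ^ (1 / q) ≤ c * D := by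
  rcases hA.eq_or_lt with rfl | hA0
  · rwa [Real.zero_rpow (by positivity)]
  refine le_of_mul_le_mul_left ?_ (Real.rpow_pos_of_pos hA0 (1 - 1 / q))
  rw [← Real.rpow_add hA0, sub_add_cancel, Real.rpow_one]
  linarith

lemma Invariant.cost_le {k : ℕ} (hk : 1 ≤ k) {q : ℝ} (hq : 1 ≤ q) {σ : List P} {x y : P → ℕ → ℝ}
    (hx : Invariant k q σ x) (hy : Feasible k σ y) :
    cost q σ x ≤ 2 * q * Real.log ((k : ℝ) + 1) * cost q σ y := by
  have hlog0 : 0 ≤ Real.log ((k : ℝ) + 1) := Real.log_nonneg (by linarith [k.cast_nonneg (α := ℝ)])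
  have hsum0 : ∀ {z : P → ℕ → ℝ}, Feasible k σ z → 0 ≤ ∑ p ∈ σ.toFinset, evictions σ z p ^ q :=
    fun hz => Finset.sum_nonneg fun p _ => Real.rpow_nonneg (hz.evictions_nonneg p) _
  have hcost : 0 ≤ cost q σ y := Real.rpow_nonneg (hsum0 hy) _
  refine rpow_le_of_le_mul_rpow hq (hsum0 hx.1) (by positivity) ?_
  calc ∑ p ∈ σ.toFinset, evictions σ x p ^ q
      ≤ q * (2 * ∑ p ∈ σ.toFinset, dualTerm q (1 / k) σ x y p) := hx.2 y hy
    _ ≤ q * (2 * ∑ p ∈ σ.toFinset,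
          Real.log (k + 1) * (evictions σ x p ^ (q - 1) * evictions σ y p)) := by
        gcongr with p
        exact dualTerm_le hk hq hx.1 hy p
    _ = 2 * q * Real.log (k + 1) *
          ∑ p ∈ σ.toFinset, evictions σ x p ^ (q - 1) * evictions σ y p := by
        rw [← Finset.mul_sum]; ring
    _ ≤ _ := by
        refine mul_le_mul_of_nonneg_left ?_ (by positivity)
        exact sum_rpow_sub_one_mul_le _ hq (fun p _ => hx.1.evictions_nonneg p)
          (fun p _ => hy.evictions_nonneg p)

end FractionalPaging

theorem mainTheorem2 (P : Type*) [DecidableEq P] (k : ℕ) (hk : 1 ≤ k) (q : ℝ) (hq : 1 ≤ q) :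
    ∃ A : FractionalPaging.OnlineAlgorithm P k,
      A.IsCompetitive q (2 * q * Real.log ((k : ℝ) + 1)) := by
  obtain ⟨f, hInv, hR⟩ := FractionalPaging.exists_online (FractionalPaging.Invariant (P := P) k q)
    FractionalPaging.Transition 0 (FractionalPaging.invariant_nil 0)
    fun σ a x h => h.exists_step hk hq a
  exact ⟨⟨f, fun σ => (hInv σ).1, fun σ a => (hR σ a).1, fun σ a => (hR σ a).2.1,
    fun σ a => (hR σ a).2.2⟩, fun σ y hy => (hInv σ).cost_le hk hq hy⟩
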